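/- Let $\Bbbk$ be a field of characteristic zero. By an algebra we mean a $\Bbbk$-vector space $A$ with a bilinear, not necessarily associative product. Let $w_n(a_1,\ldots,a_n)$ be the sum of all bracketings of the word $a_1\cdots a_n$, that is, $w_1(a_1)=a_1$ and $w_n(a_1,\ldots,a_n)=\sum_{i=1}^{n-1}w_i(a_1,\ldots,a_i)\,w_{n-i}(a_{i+1},\ldots,a_n)$. For $a\in A$ let $l_a\colon x\mapsto ax$ and $r_a\colon x\mapsto xa$, and let $L(A)$ and $R(A)$ be the (not necessarily unital) associative subalgebras of $\mathrm{End}_{\Bbbk}(A)$ generated by all $l_a$ and by all $r_a$, respectively. Let $U(A)$ be the multiplicative universal enveloping algebra of $A$ in the variety of algebras satisfying $w_4=0$: the not necessarily unital associative algebra generated by symbols $l_a,r_a$, linear in $a\in A$, subject to the relations which say that $w_4$ vanishes whenever one of its arguments lies in an $A$-bimodule $M$ and the other three in $A$, where $l_a$ acts on $M$ by $m\mapsto am$ and $r_a$ by $m\mapsto ma$. Define the "zig-zag" monomials by $m_1(a_1)=a_1$, $m_{2k}(a_1,\ldots,a_{2k})=m_{2k-1}(a_1,\ldots,a_{2k-1})\,a_{2k}$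 and $m_{2k+1}(a_1,\ldots,a_{2k+1})=a_1\,m_{2k}(a_2,\ldots,a_{2k+1})$. 1. For every algebra $A$ satisfying the identity $w_4=0$, the algebras $L(A)$ and $R(A)$ are nilpotent, with $L(A)^7=0$ and $R(A)^7=0$. The index $7$ cannot be improved: there is an algebra $A$ satisfying $w_4=0$ with $L(A)^6\neq 0$ and $R(A)^6\neq 0$. 2. There is an algebra $A$ satisfying $w_4=0$ such that no zig-zag monomial $m_n$, $n\ge 1$, vanishes identically on $A$, and such that neither the subalgebra of $\mathrm{End}_{\Bbbk}(A)$ generated by all left and right multiplications nor $U(A)$ is nilpotent. -/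

import Mathlib

universe u v

namespace WeakNil

/-- The operation `w_n`, applied to the first `n` terms of a sequence `a 0, a 1, …`:
the sum of all bracketings of the word `a 0 ⋯ a (n-1)`, organised by the outermost product,
`w_1 (a_1) = a_1` and
`w_n (a_1, …, a_n) = ∑_{i=1}^{n-1} w_i (a_1, …, a_i) * w_{n-i} (a_{i+1}, …, a_n)`.
(The value at `n = 0` is a convention.) -/
def w {A : Type*} [NonUnitalNonAssocRing A] : ℕ → (ℕ → A) → A
  | 0, _ => 0
  | 1, a => a 0
  | n + 2, a => ∑ i : Fin (n + 1), w (i + 1) a * w (n + 1 - i) (fun j => a (i + 1 + j))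
termination_by n => n

/-- The identity `w_n = 0` holds in `A`. -/
def SatisfiesW (n : ℕ) (A : Type*) [NonUnitalNonAssocRing A] : Prop :=
  ∀ a : ℕ → A, w n a = 0

/-- The five bracketings of a word of length four. -/
theorem w_four {A : Type*} [NonUnitalNonAssocRing A] (a : ℕ → A) :
    w 4 a = a 0 * (a 1 * (a 2 * a 3)) + a 0 * ((a 1 * a 2) * a 3)
      + (a 0 * a 1) * (a 2 * a 3)
      + (a 0 * (a 1 * a 2)) * a 3 + ((a 0 * a 1) * a 2) * a 3 := by
  have h1 : ∀ b : ℕ → A, w 1 b = b 0 := fun b => by rw [w]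
  have h2 : ∀ b : ℕ → A, w 2 b = b 0 * b 1 := fun b => by
    rw [w]; simp [h1]
  have h3 : ∀ b : ℕ → A, w 3 b = b 0 * (b 1 * b 2) + (b 0 * b 1) * b 2 := fun b => by
    rw [w]; simp [Fin.sum_univ_two, h1, h2]
  rw [w]
  simp [Fin.sum_univ_three, h1, h2, h3, mul_add, add_mul, add_assoc]

/-- The zig-zag monomials, on the first `n` terms of a sequence `a 0, a 1, …`:
`m_1 (a_1) = a_1`,
`m_{2k} (a_1, …, a_{2k}) = m_{2k-1} (a_1, …, a_{2k-1}) * a_{2k}`,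
`m_{2k+1} (a_1, …, a_{2k+1}) = a_1 * m_{2k} (a_2, …, a_{2k+1})`.
(The value at `n = 0` is a convention.) -/
def zigzag {A : Type*} [NonUnitalNonAssocRing A] : ℕ → (ℕ → A) → A
  | 0, _ => 0
  | 1, a => a 0
  | n + 2, a =>
    if Even n then zigzag (n + 1) a * a (n + 1)
    else a 0 * zigzag (n + 1) (fun j => a (j + 1))

section

variable (k : Type*) [Field k] (A : Type*) [NonUnitalNonAssocRing A] [Module k A]
  [IsScalarTower k A A] [SMulCommClass k A A]

/-- `L(A)`: the (not necessarily unital) associative algebra of operators on `A`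
generated by the left multiplications `l_a : x ↦ a * x`. -/
def leftAlg : NonUnitalSubalgebra k (Module.End k A) :=
  NonUnitalAlgebra.adjoin k (Set.range fun a : A => LinearMap.mulLeft k a)

/-- `R(A)`: the (not necessarily unital) associative algebra of operators on `A`
generated by the right multiplications `r_a : x ↦ x * a`. -/
def rightAlg : NonUnitalSubalgebra k (Module.End k A) :=
  NonUnitalAlgebra.adjoin k (Set.range fun a : A => LinearMap.mulRight k a)

/-- The (not necessarily unital) associative algebra of operators on `A`
generated by all left and all right multiplications. -/
def multAlg : NonUnitalSubalgebra k (Module.End k A) :=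
  NonUnitalAlgebra.adjoin k
    ((Set.range fun a : A => LinearMap.mulLeft k a) ∪
      (Set.range fun a : A => LinearMap.mulRight k a))

/-- The formal symbol `l_a`, linear in `a`. -/
def symL (a : A) : TensorAlgebra k (A × A) := TensorAlgebra.ι k (a, 0)

/-- The formal symbol `r_a`, linear in `a`. -/
def symR (a : A) : TensorAlgebra k (A × A) := TensorAlgebra.ι k (0, a)

/-- The relations on the symbols `l_a`, `r_a` saying that `w_4` vanishes whenever one of its four
arguments lies in a bimodule `M` and the other three in `A`, where `l_a` acts on `M` by `m ↦ a m`,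
`r_a` by `m ↦ m a`, and products of symbols act by composition. The constructor `argI` is the case
in which the `I`-th argument is in `M`. -/
inductive EnvRel : TensorAlgebra k (A × A) → TensorAlgebra k (A × A) → Prop
  | arg1 (b c d : A) : EnvRel
      (symR k A d * symR k A c * symR k A b + symR k A d * symR k A (b * c)
        + symR k A (c * d) * symR k A b + symR k A ((b * c) * d) + symR k A (b * (c * d))) 0
  | arg2 (a c d : A) : EnvRel
      (symR k A d * symR k A c * symL k A a + symR k A d * symL k A a * symR k A c
        + symR k A (c * d) * symL k A a + symL k A a * symR k A d * symR k A c
        + symL k A a * symR k A (c * d)) 0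
  | arg3 (a b d : A) : EnvRel
      (symR k A d * symL k A (a * b) + symR k A d * symL k A a * symL k A b
        + symL k A (a * b) * symR k A d + symL k A a * symR k A d * symL k A b
        + symL k A a * symL k A b * symR k A d) 0
  | arg4 (a b c : A) : EnvRel
      (symL k A ((a * b) * c) + symL k A (a * (b * c)) + symL k A (a * b) * symL k A c
        + symL k A a * symL k A (b * c) + symL k A a * symL k A b * symL k A c) 0

/-- The unital universal multiplicative envelope of `A` in the variety of algebras with `w_4 = 0`:
the associative algebra whose modules are the bimodules over `A` in that variety. -/
abbrev UnitalEnv : Type _ := RingQuot (EnvRel k A)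

/-- `U(A)`: the multiplicative universal enveloping algebra of `A` in the variety of algebras with
`w_4 = 0`, as the not necessarily unital associative algebra generated by the universal left and
right multiplications `l_a`, `r_a`. -/
def univMultEnv : NonUnitalSubalgebra k (UnitalEnv k A) :=
  NonUnitalAlgebra.adjoin k
    ((Set.range fun a : A => RingQuot.mkAlgHom k (EnvRel k A) (symL k A a)) ∪
      (Set.range fun a : A => RingQuot.mkAlgHom k (EnvRel k A) (symR k A a)))

end

/-- `S ^ n = 0`: every product of `n` elements of the (not necessarily unital) associative
algebra `S` vanishes. -/
def PowZero {k E : Type*} [Field k] [Ring E] [Algebra k E] (S : NonUnitalSubalgebra k E)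
    (n : ℕ) : Prop :=
  ∀ f : Fin n → E, (∀ i, f i ∈ S) → (List.ofFn f).prod = 0

end WeakNil

/-!
Nilpotency. The five summands of `w_4 (a₁, …, a₄)` are the triangulations of a pentagon with sides
`a₁, …, a₄` and an output side. This becomes cyclically symmetric on the double of `A`, the direct
sum of `A` and its dual space with the coadjoint product: there the evaluation pairing is symmetric
and invariant, so a bracketed product paired with one more element is a function of a triangulated
polygon whose sides are labelled by elements, and `w_4 = 0` says that the triangulations of a
pentagon add up to zero (`Double.cyclicForm`). Applying this to all pentagons cut out of larger
polygons gives symmetries of fans, the triangulations by all diagonals from one vertex. In a hexagon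
the difference of two opposite fans changes sign under rotation (`hex_rotate`). In a heptagon the
fan is a difference of two such hexagon terms (`hept_eq_zero`, which divides by `5`). In an octagon
every fan can therefore be expressed through hexagon terms in two ways (`fan_one`, `fan_seven`);
comparing them shows that the hexagon terms with two opposite ears vanish (`octD_eq_zero`). In an
enneagon the two expressions show that rotating a fan by two steps changes its sign
(`fan₉_rotate_two`); as nine is odd, the fan is zero (`fan₉_eq_zero`). With one side in the dual
space this says that left-normed and right-normed products of eight elements vanish, which is
`R(A)^7 = 0` and `L(A)^7 = 0`.

Sharpness. In the ten-dimensional graded algebra `SharpAlg` the sixth powers of the left and of the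
right multiplication by the element `x` of degree one are nonzero.

The zig-zag algebra. In the four-dimensional algebra `ZigZagAlg` one has `o x = e` and `x e = o`.
So the zig-zag monomials with `o` in the middle and `x` elsewhere do not vanish, and the operator
`l_x r_x` fixes `o`. As `A` is a bimodule over itself, `U(A)` acts on it (`envRep`), whence `U(A)` is
not nilpotent either.
-/

namespace WeakNil

/-! ### Triangulated polygons -/

/-- A symmetric invariant pairing on a magma satisfying the cyclic form of `w_4 = 0`.
Because of `symm` and `inv`, the value of the pairing on a bracketed product of `x₀, …, x_{n-1}`
depends only on a triangulation of the `n`-gon whose sides carry the cyclic word `x₀ ⋯ x_{n-1}`;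
`pentagon` says that the five triangulations of a pentagon sum to zero. Additivity plays no role,
so it is not required.

Below, vertex `i` of a polygon is the common end of the sides `x_{i-1}` and `x_i`, and a factor
`x_{i-1} * x_i` cuts off the ear at vertex `i`. -/
structure CyclicForm (k B : Type*) [Field k] [Mul B] where
  form : B → B → k
  symm : ∀ x y, form x y = form y x
  inv : ∀ x y z, form (x * y) z = form x (y * z)
  pentagon : ∀ x₀ x₁ x₂ x₃ x₄,
    form (((x₀ * x₁) * x₂) * x₃) x₄ + form (((x₁ * x₂) * x₃) * x₄) x₀
      + form (((x₂ * x₃) * x₄) * x₀) x₁ + form (((x₃ * x₄) * x₀) * x₁) x₂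
      + form (((x₄ * x₀) * x₁) * x₂) x₃ = 0

namespace CyclicForm

variable {k B : Type*} [Field k] [Mul B] (P : CyclicForm k B)

theorem cyc (x y z : B) : P.form x (y * z) = P.form y (z * x) := by
  rw [P.symm, P.inv]

/-- The triangulation of a hexagon by all diagonals from vertex `0`. -/
def fan₆ (x₀ x₁ x₂ x₃ x₄ x₅ : B) : k := P.form ((((x₀ * x₁) * x₂) * x₃) * x₄) x₅

/-- The triangulation of a heptagon by all diagonals from vertex `0`. -/
def fan₇ (x₀ x₁ x₂ x₃ x₄ x₅ x₆ : B) : k := P.form (((((x₀ * x₁) * x₂) * x₃) * x₄) * x₅) x₆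

/-- The difference of the fans of a hexagon at the opposite vertices `0` and `3`. -/
def hex (x₀ x₁ x₂ x₃ x₄ x₅ : B) : k :=
  P.fan₆ x₀ x₁ x₂ x₃ x₄ x₅ - P.fan₆ x₃ x₄ x₅ x₀ x₁ x₂

/-- The relation comes from the pentagons left after cutting off one ear of the hexagon, for the
ears at four of its vertices. -/
theorem hex_rotate (x₀ x₁ x₂ x₃ x₄ x₅ : B) :
    P.hex x₁ x₂ x₃ x₄ x₅ x₀ = -P.hex x₀ x₁ x₂ x₃ x₄ x₅ := by
  have h1 := P.pentagon (x₀ * x₁) x₂ x₃ x₄ x₅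
  have h0 := P.pentagon x₁ x₂ x₃ x₄ (x₅ * x₀)
  have h4 := P.pentagon (x₃ * x₄) x₅ x₀ x₁ x₂
  have h3 := P.pentagon (x₂ * x₃) x₄ x₅ x₀ x₁
  simp only [hex, fan₆, P.inv, P.cyc x₁, P.cyc x₂, P.cyc x₃, P.cyc x₄, P.cyc x₅] at *
  linear_combination h1 + h0 - h4 - h3

/-- Twice `hex` is the difference of the two triangulations of the hexagon that contain an inner
triangle. -/
theorem two_mul_hex (x₀ x₁ x₂ x₃ x₄ x₅ : B) :
    2 * P.hex x₀ x₁ x₂ x₃ x₄ x₅ =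
      P.form ((x₁ * x₂) * (x₃ * x₄)) (x₅ * x₀) - P.form ((x₀ * x₁) * (x₂ * x₃)) (x₄ * x₅) := by
  have h0 := P.pentagon x₁ x₂ x₃ x₄ (x₅ * x₀)
  have h1 := P.pentagon (x₀ * x₁) x₂ x₃ x₄ x₅
  have h2 := P.pentagon (x₁ * x₂) x₃ x₄ x₅ x₀
  have h3 := P.pentagon (x₂ * x₃) x₄ x₅ x₀ x₁
  have h4 := P.pentagon (x₃ * x₄) x₅ x₀ x₁ x₂
  have h5 := P.pentagon (x₄ * x₅) x₀ x₁ x₂ x₃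
  simp only [hex, fan₆, P.inv, P.cyc x₁, P.cyc x₂, P.cyc x₃, P.cyc x₄, P.cyc x₅] at *
  linear_combination h5 - h4 - h3 - h2 + h1 + h0

/-- A combination of triangulations of a heptagon that turns out to be invariant under rotation. -/
def hept (x₀ x₁ x₂ x₃ x₄ x₅ x₆ : B) : k :=
  P.hex x₆ x₀ x₁ x₂ x₃ (x₄ * x₅) - P.hex x₃ x₄ x₅ x₆ x₀ (x₁ * x₂) - P.fan₇ x₀ x₁ x₂ x₃ x₄ x₅ x₆

/-- Up to `hex_rotate`, this is `two_mul_hex` for the hexagon left after cutting off the ear at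
vertex `2`. -/
theorem hept_rotate_four (x₀ x₁ x₂ x₃ x₄ x₅ x₆ : B) :
    P.hept x₄ x₅ x₆ x₀ x₁ x₂ x₃ = P.hept x₀ x₁ x₂ x₃ x₄ x₅ x₆ := by
  have hT := P.two_mul_hex x₃ x₄ x₅ x₆ x₀ (x₁ * x₂)
  have h1 := P.hex_rotate x₆ x₀ x₁ x₂ x₃ (x₄ * x₅)
  have h2 := P.hex_rotate x₀ x₁ x₂ x₃ (x₄ * x₅) x₆
  simp only [hept, hex, fan₆, fan₇, P.inv, P.cyc x₁, P.cyc x₂, P.cyc x₃, P.cyc x₄, P.cyc x₅,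
    P.cyc x₆] at *
  linear_combination hT - h1 + h2

theorem hept_rotate (x₀ x₁ x₂ x₃ x₄ x₅ x₆ : B) :
    P.hept x₁ x₂ x₃ x₄ x₅ x₆ x₀ = P.hept x₀ x₁ x₂ x₃ x₄ x₅ x₆ := by
  -- `4 + 4` is `1` modulo `7`
  rw [← P.hept_rotate_four x₀ x₁ x₂ x₃ x₄ x₅ x₆, ← P.hept_rotate_four x₄ x₅ x₆ x₀ x₁ x₂ x₃]

/-- The pentagon left after cutting off two ears of the heptagon says that five rotations of `hept`
sum to zero, and all rotations are equal. -/
theorem hept_eq_zero (h5 : (5 : k) ≠ 0) (x₀ x₁ x₂ x₃ x₄ x₅ x₆ : B) :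
    P.hept x₀ x₁ x₂ x₃ x₄ x₅ x₆ = 0 := by
  -- the pentagon left after cutting off the ears at the vertices `0` and `2`
  have h := P.pentagon (x₆ * x₀) (x₁ * x₂) x₃ x₄ x₅
  have r1 := P.hept_rotate x₀ x₁ x₂ x₃ x₄ x₅ x₆
  have r2 := P.hept_rotate x₁ x₂ x₃ x₄ x₅ x₆ x₀
  have r3 := P.hept_rotate x₂ x₃ x₄ x₅ x₆ x₀ x₁
  have r4 := P.hept_rotate x₃ x₄ x₅ x₆ x₀ x₁ x₂
  have r5 := P.hept_rotate x₄ x₅ x₆ x₀ x₁ x₂ x₃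
  have r6 := P.hept_rotate x₅ x₆ x₀ x₁ x₂ x₃ x₄
  have key : P.hept x₁ x₂ x₃ x₄ x₅ x₆ x₀ + P.hept x₃ x₄ x₅ x₆ x₀ x₁ x₂
      + P.hept x₄ x₅ x₆ x₀ x₁ x₂ x₃ + P.hept x₅ x₆ x₀ x₁ x₂ x₃ x₄
      + P.hept x₆ x₀ x₁ x₂ x₃ x₄ x₅ = 0 := by
    have h1 := P.hex_rotate x₆ x₀ x₁ x₂ x₃ (x₄ * x₅)
    have h2 := P.hex_rotate x₀ x₁ x₂ x₃ (x₄ * x₅) x₆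
    have g1 := P.hex_rotate x₁ x₂ x₃ x₄ x₅ (x₆ * x₀)
    have g2 := P.hex_rotate x₂ x₃ x₄ x₅ (x₆ * x₀) x₁
    simp only [hept, hex, fan₆, fan₇, P.inv, P.cyc x₁, P.cyc x₂, P.cyc x₃, P.cyc x₄, P.cyc x₅,
      P.cyc x₆] at *
    linear_combination -h - h1 + h2 - g1 + g2
  -- all five summands of `key` are equal by rotation invariance
  apply (mul_eq_zero_iff_left h5).mp
  linear_combination key - 5 * r1 - 4 * (r2 + r3) - 3 * r4 - 2 * r5 - r6

/-! ### Octagons and enneagons -/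

/-- The triangulation of an octagon by all diagonals from vertex `0`. -/
def fan₈ (x₀ x₁ x₂ x₃ x₄ x₅ x₆ x₇ : B) : k :=
  P.form ((((((x₀ * x₁) * x₂) * x₃) * x₄) * x₅) * x₆) x₇

/-- `hex` of the hexagon left after cutting off the ears of an octagon at the vertices `0` and `2`.
-/
def octA (x₀ x₁ x₂ x₃ x₄ x₅ x₆ x₇ : B) : k :=
  P.hex x₃ x₄ x₅ x₆ (x₇ * x₀) (x₁ * x₂)

/-- `hex` of the hexagon left after cutting off the ears of an octagon at the vertices `0` and `3`.
-/
def octB (x₀ x₁ x₂ x₃ x₄ x₅ x₆ x₇ : B) : k :=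
  P.hex x₄ x₅ x₆ (x₇ * x₀) x₁ (x₂ * x₃)

/-- `hex` of the hexagon left after cutting off the ears of an octagon at the vertices `0` and `4`.
-/
def octD (x₀ x₁ x₂ x₃ x₄ x₅ x₆ x₇ : B) : k :=
  P.hex x₅ x₆ (x₇ * x₀) x₁ x₂ (x₃ * x₄)

/-- The ear of an octagon at vertex `0` with the fan of the remaining heptagon at vertex `4`. -/
def octM (x₀ x₁ x₂ x₃ x₄ x₅ x₆ x₇ : B) : k :=
  P.fan₇ x₄ x₅ x₆ (x₇ * x₀) x₁ x₂ x₃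

/-- The ear of an octagon at vertex `0` with the fan of the remaining heptagon at vertex `3`. -/
def octG (x₀ x₁ x₂ x₃ x₄ x₅ x₆ x₇ : B) : k :=
  P.fan₇ x₃ x₄ x₅ x₆ (x₇ * x₀) x₁ x₂

/-- The ear of an octagon at vertex `0` with the fan of the remaining heptagon at vertex `5`. -/
def octH (x₀ x₁ x₂ x₃ x₄ x₅ x₆ x₇ : B) : k :=
  P.fan₇ x₅ x₆ (x₇ * x₀) x₁ x₂ x₃ x₄

theorem octB_eq (x₀ x₁ x₂ x₃ x₄ x₅ x₆ x₇ : B) :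
    P.octB x₀ x₁ x₂ x₃ x₄ x₅ x₆ x₇ =
      P.octM x₀ x₁ x₂ x₃ x₄ x₅ x₆ x₇ - P.octM x₃ x₄ x₅ x₆ x₇ x₀ x₁ x₂ := by
  simp only [octB, octM, hex, fan₆, fan₇, P.inv, P.cyc x₄, P.cyc x₅, P.cyc x₆, P.cyc x₇] at *

theorem octG_sub (x₀ x₁ x₂ x₃ x₄ x₅ x₆ x₇ : B) :
    P.octG x₀ x₁ x₂ x₃ x₄ x₅ x₆ x₇ - P.octG x₄ x₅ x₆ x₇ x₀ x₁ x₂ x₃ =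
      -P.octD x₀ x₁ x₂ x₃ x₄ x₅ x₆ x₇ := by
  have h1 := P.hex_rotate x₅ x₆ (x₇ * x₀) x₁ x₂ (x₃ * x₄)
  have h2 := P.hex_rotate x₆ (x₇ * x₀) x₁ x₂ (x₃ * x₄) x₅
  simp only [octD, octG, hex, fan₆, fan₇, P.inv, P.cyc x₁, P.cyc x₂, P.cyc x₃, P.cyc x₄, P.cyc x₅,
    P.cyc x₆, P.cyc x₇] at *
  linear_combination h1 - h2

theorem octH_sub (x₀ x₁ x₂ x₃ x₄ x₅ x₆ x₇ : B) :
    P.octH x₀ x₁ x₂ x₃ x₄ x₅ x₆ x₇ - P.octH x₄ x₅ x₆ x₇ x₀ x₁ x₂ x₃ =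
      P.octD x₀ x₁ x₂ x₃ x₄ x₅ x₆ x₇ := by
  simp only [octD, octH, hex, fan₆, fan₇, P.inv, P.cyc x₁, P.cyc x₂, P.cyc x₃, P.cyc x₄, P.cyc x₅,
    P.cyc x₆, P.cyc x₇] at *

theorem two_mul_octB (x₀ x₁ x₂ x₃ x₄ x₅ x₆ x₇ : B) :
    2 * P.octB x₀ x₁ x₂ x₃ x₄ x₅ x₆ x₇ = P.octH x₀ x₁ x₂ x₃ x₄ x₅ x₆ x₇
      - P.octA x₆ x₇ x₀ x₁ x₂ x₃ x₄ x₅ - P.octG x₃ x₄ x₅ x₆ x₇ x₀ x₁ x₂ + P.octA x₃ x₄ x₅ x₆ x₇ x₀ x₁ x₂ := by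
  have hT := P.two_mul_hex x₄ x₅ x₆ (x₇ * x₀) x₁ (x₂ * x₃)
  have h1 := P.hex_rotate x₁ x₂ x₃ x₄ (x₅ * x₆) (x₇ * x₀)
  simp only [octA, octB, octG, octH, hex, fan₆, fan₇, P.inv, P.cyc x₁, P.cyc x₂, P.cyc x₃,
    P.cyc x₄, P.cyc x₅, P.cyc x₆, P.cyc x₇] at *
  linear_combination hT + h1

theorem octM_eq (h5 : (5 : k) ≠ 0) (x₀ x₁ x₂ x₃ x₄ x₅ x₆ x₇ : B) :
    P.octM x₀ x₁ x₂ x₃ x₄ x₅ x₆ x₇ =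
      P.octA x₀ x₁ x₂ x₃ x₄ x₅ x₆ x₇ + P.octA x₆ x₇ x₀ x₁ x₂ x₃ x₄ x₅ := by
  have h := P.hept_eq_zero h5 x₄ x₅ x₆ (x₇ * x₀) x₁ x₂ x₃
  have h1 := P.hex_rotate (x₇ * x₀) x₁ x₂ x₃ x₄ (x₅ * x₆)
  simp only [hept, octA, octM, hex, fan₆, fan₇, P.inv, P.cyc x₁, P.cyc x₂, P.cyc x₃, P.cyc x₄,
    P.cyc x₅, P.cyc x₆, P.cyc x₇] at *
  linear_combination -h - h1

/-- `hept_eq_zero` for the heptagon left after cutting off an ear, solved for the octagon fan. -/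
theorem fan_one (h5 : (5 : k) ≠ 0) (x₀ x₁ x₂ x₃ x₄ x₅ x₆ x₇ : B) :
    P.fan₈ x₁ x₂ x₃ x₄ x₅ x₆ x₇ x₀ =
      -P.octA x₆ x₇ x₀ x₁ x₂ x₃ x₄ x₅ - P.octB x₀ x₁ x₂ x₃ x₄ x₅ x₆ x₇ := by
  have h := P.hept_eq_zero h5 x₁ x₂ x₃ x₄ x₅ x₆ (x₇ * x₀)
  have h1 := P.hex_rotate (x₇ * x₀) x₁ x₂ x₃ x₄ (x₅ * x₆)
  simp only [hept, octA, octB, hex, fan₆, fan₇, fan₈, P.inv, P.cyc x₁, P.cyc x₂, P.cyc x₃,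
    P.cyc x₄, P.cyc x₅, P.cyc x₆, P.cyc x₇] at *
  linear_combination -h + h1

/-- The counterpart of `fan_one` for the other octagon fan that contains the ear at vertex `0`. -/
theorem fan_seven (h5 : (5 : k) ≠ 0) (x₀ x₁ x₂ x₃ x₄ x₅ x₆ x₇ : B) :
    P.fan₈ x₇ x₀ x₁ x₂ x₃ x₄ x₅ x₆ =
      P.octB x₅ x₆ x₇ x₀ x₁ x₂ x₃ x₄ - P.octA x₀ x₁ x₂ x₃ x₄ x₅ x₆ x₇ := by
  have h := P.hept_eq_zero h5 (x₇ * x₀) x₁ x₂ x₃ x₄ x₅ x₆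
  have h1 := P.hex_rotate x₆ (x₇ * x₀) x₁ x₂ x₃ (x₄ * x₅)
  have h2 := P.hex_rotate (x₇ * x₀) x₁ x₂ x₃ (x₄ * x₅) x₆
  simp only [hept, octA, octB, hex, fan₆, fan₇, fan₈, P.inv, P.cyc x₁, P.cyc x₂, P.cyc x₃,
    P.cyc x₄, P.cyc x₅, P.cyc x₆, P.cyc x₇] at *
  linear_combination -h + h1 - h2

/-- Both `fan_one` and `fan_seven` compute the same fan of the octagon; their comparison gives this
relation. -/
theorem octM_sub (h5 : (5 : k) ≠ 0) (x₀ x₁ x₂ x₃ x₄ x₅ x₆ x₇ : B) :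
    P.octM x₀ x₁ x₂ x₃ x₄ x₅ x₆ x₇ - P.octM x₄ x₅ x₆ x₇ x₀ x₁ x₂ x₃ =
      2 * (P.octA x₃ x₄ x₅ x₆ x₇ x₀ x₁ x₂ - P.octA x₇ x₀ x₁ x₂ x₃ x₄ x₅ x₆) := by
  have f1 := P.fan_one h5 x₅ x₆ x₇ x₀ x₁ x₂ x₃ x₄
  have f2 := P.fan_seven h5 x₇ x₀ x₁ x₂ x₃ x₄ x₅ x₆
  have b1 := P.octB_eq x₅ x₆ x₇ x₀ x₁ x₂ x₃ x₄
  have b2 := P.octB_eq x₄ x₅ x₆ x₇ x₀ x₁ x₂ x₃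
  have m1 := P.octM_eq h5 x₅ x₆ x₇ x₀ x₁ x₂ x₃ x₄
  have m2 := P.octM_eq h5 x₇ x₀ x₁ x₂ x₃ x₄ x₅ x₆
  linear_combination f2 - f1 + b1 + b2 + m1 - m2

theorem octA_rotate_four (h5 : (5 : k) ≠ 0) (h2 : (2 : k) ≠ 0)
    (x₀ x₁ x₂ x₃ x₄ x₅ x₆ x₇ : B) :
    P.octA x₄ x₅ x₆ x₇ x₀ x₁ x₂ x₃ = P.octA x₀ x₁ x₂ x₃ x₄ x₅ x₆ x₇ := by
  have m0 := P.octM_eq h5 x₀ x₁ x₂ x₃ x₄ x₅ x₆ x₇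
  have m1 := P.octM_eq h5 x₁ x₂ x₃ x₄ x₅ x₆ x₇ x₀
  have m2 := P.octM_eq h5 x₂ x₃ x₄ x₅ x₆ x₇ x₀ x₁
  have m3 := P.octM_eq h5 x₃ x₄ x₅ x₆ x₇ x₀ x₁ x₂
  have m4 := P.octM_eq h5 x₄ x₅ x₆ x₇ x₀ x₁ x₂ x₃
  have m5 := P.octM_eq h5 x₅ x₆ x₇ x₀ x₁ x₂ x₃ x₄
  have m6 := P.octM_eq h5 x₆ x₇ x₀ x₁ x₂ x₃ x₄ x₅
  have m7 := P.octM_eq h5 x₇ x₀ x₁ x₂ x₃ x₄ x₅ x₆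
  have s0 := P.octM_sub h5 x₀ x₁ x₂ x₃ x₄ x₅ x₆ x₇
  have s1 := P.octM_sub h5 x₁ x₂ x₃ x₄ x₅ x₆ x₇ x₀
  have s2 := P.octM_sub h5 x₂ x₃ x₄ x₅ x₆ x₇ x₀ x₁
  have s3 := P.octM_sub h5 x₃ x₄ x₅ x₆ x₇ x₀ x₁ x₂
  refine sub_eq_zero.mp ((mul_eq_zero_iff_left h2).mp ?_)
  linear_combination s0 - m0 + m4 + (s2 - m2 + m6) - 2 * (s1 - m1 + m5)

theorem octB_rotate (h5 : (5 : k) ≠ 0) (h2 : (2 : k) ≠ 0)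
    (x₀ x₁ x₂ x₃ x₄ x₅ x₆ x₇ : B) :
    P.octB x₁ x₂ x₃ x₄ x₅ x₆ x₇ x₀ = -P.octB x₀ x₁ x₂ x₃ x₄ x₅ x₆ x₇ := by
  have b0 := P.octB_eq x₀ x₁ x₂ x₃ x₄ x₅ x₆ x₇
  have b1 := P.octB_eq x₁ x₂ x₃ x₄ x₅ x₆ x₇ x₀
  have m0 := P.octM_eq h5 x₀ x₁ x₂ x₃ x₄ x₅ x₆ x₇
  have m1 := P.octM_eq h5 x₁ x₂ x₃ x₄ x₅ x₆ x₇ x₀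
  have m3 := P.octM_eq h5 x₃ x₄ x₅ x₆ x₇ x₀ x₁ x₂
  have m4 := P.octM_eq h5 x₄ x₅ x₆ x₇ x₀ x₁ x₂ x₃
  have a0 := P.octA_rotate_four h5 h2 x₀ x₁ x₂ x₃ x₄ x₅ x₆ x₇
  have a2 := P.octA_rotate_four h5 h2 x₂ x₃ x₄ x₅ x₆ x₇ x₀ x₁
  have a3 := P.octA_rotate_four h5 h2 x₃ x₄ x₅ x₆ x₇ x₀ x₁ x₂
  linear_combination b0 + b1 + m0 + m1 - m3 - m4 - a0 + a2 + a3

theorem octD_rotate_three (h5 : (5 : k) ≠ 0) (h2 : (2 : k) ≠ 0)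
    (x₀ x₁ x₂ x₃ x₄ x₅ x₆ x₇ : B) :
    P.octD x₃ x₄ x₅ x₆ x₇ x₀ x₁ x₂ = -P.octD x₀ x₁ x₂ x₃ x₄ x₅ x₆ x₇ := by
  have g0 := P.octH_sub x₀ x₁ x₂ x₃ x₄ x₅ x₆ x₇
  have g3 := P.octG_sub x₃ x₄ x₅ x₆ x₇ x₀ x₁ x₂
  have t0 := P.two_mul_octB x₀ x₁ x₂ x₃ x₄ x₅ x₆ x₇
  have t4 := P.two_mul_octB x₄ x₅ x₆ x₇ x₀ x₁ x₂ x₃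
  have b0 := P.octB_rotate h5 h2 x₀ x₁ x₂ x₃ x₄ x₅ x₆ x₇
  have b1 := P.octB_rotate h5 h2 x₁ x₂ x₃ x₄ x₅ x₆ x₇ x₀
  have b2 := P.octB_rotate h5 h2 x₂ x₃ x₄ x₅ x₆ x₇ x₀ x₁
  have b3 := P.octB_rotate h5 h2 x₃ x₄ x₅ x₆ x₇ x₀ x₁ x₂
  have a2 := P.octA_rotate_four h5 h2 x₂ x₃ x₄ x₅ x₆ x₇ x₀ x₁
  have a3 := P.octA_rotate_four h5 h2 x₃ x₄ x₅ x₆ x₇ x₀ x₁ x₂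
  linear_combination -g0 + g3 - t0 + t4 - 2 * (b3 - b2 + b1 - b0) + a2 + a3

/-- By `octG_sub` the rotation by `4` changes the sign of `octD`. But `4` is four times `3` modulo
`8`, so by `octD_rotate_three` the rotation by `4` also preserves `octD`. -/
theorem octD_eq_zero (h5 : (5 : k) ≠ 0) (h2 : (2 : k) ≠ 0)
    (x₀ x₁ x₂ x₃ x₄ x₅ x₆ x₇ : B) : P.octD x₀ x₁ x₂ x₃ x₄ x₅ x₆ x₇ = 0 := by
  have g0 := P.octG_sub x₀ x₁ x₂ x₃ x₄ x₅ x₆ x₇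
  have g4 := P.octG_sub x₄ x₅ x₆ x₇ x₀ x₁ x₂ x₃
  have d0 := P.octD_rotate_three h5 h2 x₀ x₁ x₂ x₃ x₄ x₅ x₆ x₇
  have d3 := P.octD_rotate_three h5 h2 x₃ x₄ x₅ x₆ x₇ x₀ x₁ x₂
  have d6 := P.octD_rotate_three h5 h2 x₆ x₇ x₀ x₁ x₂ x₃ x₄ x₅
  have d1 := P.octD_rotate_three h5 h2 x₁ x₂ x₃ x₄ x₅ x₆ x₇ x₀
  refine (mul_eq_zero_iff_left h2).mp ?_
  linear_combination g0 + g4 - d1 + d6 - d3 + d0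

/-- The triangulation of an enneagon by all diagonals from vertex `0`. -/
def fan₉ (x₀ x₁ x₂ x₃ x₄ x₅ x₆ x₇ x₈ : B) : k :=
  P.form (((((((x₀ * x₁) * x₂) * x₃) * x₄) * x₅) * x₆) * x₇) x₈

/-- An enneagon fan is an octagon fan after cutting off an ear, in two ways. Up to sign, the
terms `octB` in `fan_one` and `fan_seven` are `octD` of another octagon cut out of the enneagon, so
they vanish, and the terms `octA` differ by one rotation of a common hexagon. -/
theorem fan₉_rotate_two (h5 : (5 : k) ≠ 0) (h2 : (2 : k) ≠ 0)
    (x₀ x₁ x₂ x₃ x₄ x₅ x₆ x₇ x₈ : B) :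
    P.fan₉ x₂ x₃ x₄ x₅ x₆ x₇ x₈ x₀ x₁ = -P.fan₉ x₀ x₁ x₂ x₃ x₄ x₅ x₆ x₇ x₈ := by
  have f₂ : P.fan₉ x₂ x₃ x₄ x₅ x₆ x₇ x₈ x₀ x₁ = _ := P.fan_one h5 x₁ (x₂ * x₃) x₄ x₅ x₆ x₇ x₈ x₀
  have f₀ := P.fan_seven h5 x₁ x₂ x₃ x₄ x₅ x₆ (x₇ * x₈) x₀
  have e₀ : P.fan₈ x₀ x₁ x₂ x₃ x₄ x₅ x₆ (x₇ * x₈) = P.fan₉ x₀ x₁ x₂ x₃ x₄ x₅ x₆ x₇ x₈ :=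
    (P.inv _ _ _).symm
  have d₂ : P.octB x₅ x₆ x₇ x₈ x₀ x₁ (x₂ * x₃) x₄ = 0 :=
    P.octD_eq_zero h5 h2 x₃ (x₄ * x₅) x₆ x₇ x₈ x₀ x₁ x₂
  have d₀ : P.octB x₁ x₂ x₃ x₄ x₅ x₆ (x₇ * x₈) x₀ = 0 :=
    P.octD_eq_zero h5 h2 x₈ (x₀ * x₁) x₂ x₃ x₄ x₅ x₆ x₇
  have d₂' : P.octB x₁ (x₂ * x₃) x₄ x₅ x₆ x₇ x₈ x₀ = 0 := by
    have r0 := P.octB_rotate h5 h2 x₁ (x₂ * x₃) x₄ x₅ x₆ x₇ x₈ x₀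
    have r1 := P.octB_rotate h5 h2 (x₂ * x₃) x₄ x₅ x₆ x₇ x₈ x₀ x₁
    have r2 := P.octB_rotate h5 h2 x₄ x₅ x₆ x₇ x₈ x₀ x₁ (x₂ * x₃)
    linear_combination r0 - r1 + r2 - d₂
  have d₀' : P.octB x₆ (x₇ * x₈) x₀ x₁ x₂ x₃ x₄ x₅ = 0 := by
    have r0 := P.octB_rotate h5 h2 x₁ x₂ x₃ x₄ x₅ x₆ (x₇ * x₈) x₀
    have r1 := P.octB_rotate h5 h2 x₂ x₃ x₄ x₅ x₆ (x₇ * x₈) x₀ x₁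
    have r2 := P.octB_rotate h5 h2 x₃ x₄ x₅ x₆ (x₇ * x₈) x₀ x₁ x₂
    have r3 := P.octB_rotate h5 h2 x₄ x₅ x₆ (x₇ * x₈) x₀ x₁ x₂ x₃
    have r4 := P.octB_rotate h5 h2 x₅ x₆ (x₇ * x₈) x₀ x₁ x₂ x₃ x₄
    linear_combination r4 - r3 + r2 - r1 + r0 - d₀
  have r : P.octA x₁ x₂ x₃ x₄ x₅ x₆ (x₇ * x₈) x₀ = -P.octA x₈ x₀ x₁ (x₂ * x₃) x₄ x₅ x₆ x₇ :=
    P.hex_rotate (x₂ * x₃) x₄ x₅ x₆ (x₇ * x₈) (x₀ * x₁)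
  linear_combination f₂ + f₀ - e₀ - d₂' + d₀' - r

/-- Rotating by `2` nine times, an odd number, gives back the same fan with the opposite sign. -/
theorem fan₉_eq_zero (h5 : (5 : k) ≠ 0) (h2 : (2 : k) ≠ 0)
    (x₀ x₁ x₂ x₃ x₄ x₅ x₆ x₇ x₈ : B) : P.fan₉ x₀ x₁ x₂ x₃ x₄ x₅ x₆ x₇ x₈ = 0 := by
  have r0 := P.fan₉_rotate_two h5 h2 x₀ x₁ x₂ x₃ x₄ x₅ x₆ x₇ x₈
  have r1 := P.fan₉_rotate_two h5 h2 x₂ x₃ x₄ x₅ x₆ x₇ x₈ x₀ x₁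
  have r2 := P.fan₉_rotate_two h5 h2 x₄ x₅ x₆ x₇ x₈ x₀ x₁ x₂ x₃
  have r3 := P.fan₉_rotate_two h5 h2 x₆ x₇ x₈ x₀ x₁ x₂ x₃ x₄ x₅
  have r4 := P.fan₉_rotate_two h5 h2 x₈ x₀ x₁ x₂ x₃ x₄ x₅ x₆ x₇
  have r5 := P.fan₉_rotate_two h5 h2 x₁ x₂ x₃ x₄ x₅ x₆ x₇ x₈ x₀
  have r6 := P.fan₉_rotate_two h5 h2 x₃ x₄ x₅ x₆ x₇ x₈ x₀ x₁ x₂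
  have r7 := P.fan₉_rotate_two h5 h2 x₅ x₆ x₇ x₈ x₀ x₁ x₂ x₃ x₄
  have r8 := P.fan₉_rotate_two h5 h2 x₇ x₈ x₀ x₁ x₂ x₃ x₄ x₅ x₆
  refine (mul_eq_zero_iff_left h2).mp ?_
  linear_combination r8 - r7 + r6 - r5 + r4 - r3 + r2 - r1 + r0

end CyclicForm

/-! ### The double of an algebra -/

section Nilpotency

variable {k A : Type*} [Field k] [NonUnitalNonAssocRing A] [Module k A]
  [IsScalarTower k A A] [SMulCommClass k A A]

variable (k A) in
/-- The double of `A`: the direct sum of `A` and its dual space, with the split null extension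
product coming from the coadjoint bimodule, `(a, f) * (b, g) = (a * b, x ↦ f (b * x) + g (x * a))`.
It is a type of its own because the product type has the componentwise product. -/
structure Double where
  /-- the component in `A` -/
  fst : A
  /-- the component in the dual space -/
  snd : Module.Dual k A

instance : Mul (Double k A) where
  mul p q := ⟨p.fst * q.fst,
    p.snd ∘ₗ LinearMap.mulLeft k q.fst + q.snd ∘ₗ LinearMap.mulRight k p.fst⟩

theorem Double.fst_mul (p q : Double k A) : (p * q).fst = p.fst * q.fst := rfl

theorem Double.snd_mul (p q : Double k A) (x : A) :
    (p * q).snd x = p.snd (q.fst * x) + q.snd (x * p.fst) := rfl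

theorem w_four_eq_zero (hA : SatisfiesW 4 A) (a b c d : A) :
    a * (b * (c * d)) + a * ((b * c) * d) + (a * b) * (c * d) + (a * (b * c)) * d
      + ((a * b) * c) * d = 0 := by
  have h := hA (fun i => if i = 0 then a else if i = 1 then b else if i = 2 then c else d)
  rw [w_four] at h
  simpa using h

/-- The pairing of `A` with its dual space turns the identity `w_4 = 0` of `A` into its cyclic
form on the double. -/
def Double.cyclicForm (hA : SatisfiesW 4 A) : CyclicForm k (Double k A) where
  form p q := p.snd q.fst + q.snd p.fst
  symm p q := add_comm _ _
  inv p q r := by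
    simp only [Double.fst_mul, Double.snd_mul]; ring
  pentagon p₀ p₁ p₂ p₃ p₄ := by
    have h (g : Module.Dual k A) (a b c d : A) := congrArg g (w_four_eq_zero hA a b c d)
    simp only [map_add, map_zero] at h
    simp only [Double.fst_mul, Double.snd_mul]
    linear_combination h p₀.snd p₁.fst p₂.fst p₃.fst p₄.fst + h p₁.snd p₂.fst p₃.fst p₄.fst p₀.fst
      + h p₂.snd p₃.fst p₄.fst p₀.fst p₁.fst + h p₃.snd p₄.fst p₀.fst p₁.fst p₂.fst
      + h p₄.snd p₀.fst p₁.fst p₂.fst p₃.fst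

variable (k) in
theorem leftNormed_eq_zero [CharZero k] (hA : SatisfiesW 4 A) (a₀ a₁ a₂ a₃ a₄ a₅ a₆ a₇ : A) :
    ((((((a₀ * a₁) * a₂) * a₃) * a₄) * a₅) * a₆) * a₇ = 0 := by
  refine (Module.forall_dual_apply_eq_zero_iff k _).mp fun f => ?_
  have h := (Double.cyclicForm hA).fan₉_eq_zero (k := k) (by norm_num) (by norm_num) ⟨a₀, 0⟩ ⟨a₁, 0⟩
    ⟨a₂, 0⟩ ⟨a₃, 0⟩ ⟨a₄, 0⟩ ⟨a₅, 0⟩ ⟨a₆, 0⟩ ⟨a₇, 0⟩ ⟨0, f⟩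
  simpa [CyclicForm.fan₉, Double.cyclicForm, Double.fst_mul, Double.snd_mul] using h

variable (k) in
theorem rightNormed_eq_zero [CharZero k] (hA : SatisfiesW 4 A) (a₀ a₁ a₂ a₃ a₄ a₅ a₆ a₇ : A) :
    a₀ * (a₁ * (a₂ * (a₃ * (a₄ * (a₅ * (a₆ * a₇)))))) = 0 := by
  refine (Module.forall_dual_apply_eq_zero_iff k _).mp fun f => ?_
  have h := (Double.cyclicForm hA).fan₉_eq_zero (k := k) (by norm_num) (by norm_num) ⟨0, f⟩ ⟨a₀, 0⟩
    ⟨a₁, 0⟩ ⟨a₂, 0⟩ ⟨a₃, 0⟩ ⟨a₄, 0⟩ ⟨a₅, 0⟩ ⟨a₆, 0⟩ ⟨a₇, 0⟩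
  simpa [CyclicForm.fan₉, Double.cyclicForm, Double.fst_mul, Double.snd_mul] using h

/-! ### Nilpotency of `L(A)` and `R(A)` -/

theorem exists_list_of_mem_closure {E : Type*} [Monoid E] {S : Set E} {x : E}
    (hx : x ∈ Subsemigroup.closure S) : ∃ t : List E, t ≠ [] ∧ (∀ s ∈ t, s ∈ S) ∧ t.prod = x := by
  induction hx using Subsemigroup.closure_induction with
  | mem x hx => exact ⟨[x], by simp, by simpa using hx, by simp⟩
  | mul x y _ _ hx hy =>
    obtain ⟨t, ht, hts, rfl⟩ := hx
    obtain ⟨u, -, hus, rfl⟩ := hy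
    refine ⟨t ++ u, by simp [ht], fun s hs => ?_, by simp⟩
    exact (List.mem_append.mp hs).elim (hts s) (hus s)

/-- If all products of `n` elements of `S` vanish, then the `n`-th power of the (not necessarily
unital) algebra generated by `S` is zero. -/
theorem powZero_adjoin {k E : Type*} [Field k] [Ring E] [Algebra k E] (S : Set E) (n : ℕ)
    (hS : ∀ l : List E, l.length = n → (∀ s ∈ l, s ∈ S) → l.prod = 0) :
    PowZero (NonUnitalAlgebra.adjoin k S) n := by
  -- the factors are expanded into words in the generators one at a time, from the right
  have key : ∀ l : List E, (∀ f ∈ l, f ∈ NonUnitalAlgebra.adjoin k S) → ∀ r : List E,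
      (∀ s ∈ r, s ∈ S) → n ≤ l.length + r.length → l.prod * r.prod = 0 := by
    intro l
    induction l using List.reverseRecOn with
    | nil =>
      intro _ r hr hn
      have h := hS (r.take n) (by simpa using hn) fun s hs => hr s (List.mem_of_mem_take hs)
      rw [← List.take_append_drop n r, List.prod_append, h]
      simp
    | append_singleton l f ih =>
      intro hl r hr hn
      have hl' : ∀ f ∈ l, f ∈ NonUnitalAlgebra.adjoin k S := fun g hg => hl g (by simp [hg])
      have hf : f ∈ Submodule.span k (Subsemigroup.closure S : Set E) := by
        rw [← NonUnitalAlgebra.adjoin_eq_span]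
        exact hl f (by simp)
      rw [List.prod_append, List.prod_singleton]
      rw [List.length_append, List.length_singleton] at hn
      clear hl
      induction hf using Submodule.span_induction with
      | mem x hx =>
        obtain ⟨t, ht, hts, rfl⟩ := exists_list_of_mem_closure hx
        rw [mul_assoc, ← List.prod_append]
        refine ih hl' (t ++ r) (fun s hs => (List.mem_append.mp hs).elim (hts s) (hr s)) ?_
        have := List.length_pos_iff.mpr ht
        rw [List.length_append]
        omega
      | zero => simp
      | add x y _ _ hx hy => rw [mul_add, add_mul, hx, hy, add_zero]
      | smul c x _ hx => rw [mul_smul_comm, smul_mul_assoc, hx, smul_zero]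
  intro f hf
  simpa using key (List.ofFn f) (by simpa [List.mem_ofFn] using hf) [] (by simp) (by simp)

variable (k) in
theorem powZero_leftAlg [CharZero k] (hA : SatisfiesW 4 A) : PowZero (leftAlg k A) 7 := by
  refine powZero_adjoin _ 7 fun l hl hs => ?_
  obtain ⟨m, rfl⟩ : l ∈ Set.range (List.map fun a : A => LinearMap.mulLeft k a) := by
    rwa [Set.range_list_map]
  match m, hl with
  | [a₀, a₁, a₂, a₃, a₄, a₅, a₆], _ =>
    ext x
    simpa using rightNormed_eq_zero k hA a₀ a₁ a₂ a₃ a₄ a₅ a₆ x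

variable (k) in
theorem powZero_rightAlg [CharZero k] (hA : SatisfiesW 4 A) : PowZero (rightAlg k A) 7 := by
  refine powZero_adjoin _ 7 fun l hl hs => ?_
  obtain ⟨m, rfl⟩ : l ∈ Set.range (List.map fun a : A => LinearMap.mulRight k a) := by
    rwa [Set.range_list_map]
  match m, hl with
  | [a₀, a₁, a₂, a₃, a₄, a₅, a₆], _ =>
    ext x
    simpa using leftNormed_eq_zero k hA x a₆ a₅ a₄ a₃ a₂ a₁ a₀

end Nilpotency

/-! ### The zig-zag algebra and its enveloping algebra -/

section ZigZag

variable (k : Type*) [Field k]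

/-- The algebra with basis `x, e, o, f` in which the only nonzero products of basis vectors are
`x e = o`, `x o = f`, `o x = e` and `f x = -o`. -/
@[ext]
structure ZigZagAlg where
  /-- the coordinate at `x` -/
  x : k
  /-- the coordinate at `e` -/
  e : k
  /-- the coordinate at `o` -/
  o : k
  /-- the coordinate at `f` -/
  f : k

namespace ZigZagAlg

variable {k}

instance : Zero (ZigZagAlg k) := ⟨⟨0, 0, 0, 0⟩⟩
instance : Add (ZigZagAlg k) := ⟨fun p q => ⟨p.x + q.x, p.e + q.e, p.o + q.o, p.f + q.f⟩⟩
instance : Neg (ZigZagAlg k) := ⟨fun p => ⟨-p.x, -p.e, -p.o, -p.f⟩⟩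
instance : SMul k (ZigZagAlg k) := ⟨fun c p => ⟨c * p.x, c * p.e, c * p.o, c * p.f⟩⟩
instance : Mul (ZigZagAlg k) :=
  ⟨fun p q => ⟨0, p.o * q.x, p.x * q.e - p.f * q.x, p.x * q.o⟩⟩

@[simp] theorem x_zero : (0 : ZigZagAlg k).x = 0 := rfl
@[simp] theorem e_zero : (0 : ZigZagAlg k).e = 0 := rfl
@[simp] theorem o_zero : (0 : ZigZagAlg k).o = 0 := rfl
@[simp] theorem f_zero : (0 : ZigZagAlg k).f = 0 := rfl
@[simp] theorem x_add (p q : ZigZagAlg k) : (p + q).x = p.x + q.x := rfl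
@[simp] theorem e_add (p q : ZigZagAlg k) : (p + q).e = p.e + q.e := rfl
@[simp] theorem o_add (p q : ZigZagAlg k) : (p + q).o = p.o + q.o := rfl
@[simp] theorem f_add (p q : ZigZagAlg k) : (p + q).f = p.f + q.f := rfl
@[simp] theorem x_neg (p : ZigZagAlg k) : (-p).x = -p.x := rfl
@[simp] theorem e_neg (p : ZigZagAlg k) : (-p).e = -p.e := rfl
@[simp] theorem o_neg (p : ZigZagAlg k) : (-p).o = -p.o := rfl
@[simp] theorem f_neg (p : ZigZagAlg k) : (-p).f = -p.f := rfl
@[simp] theorem x_smul (c : k) (p : ZigZagAlg k) : (c • p).x = c * p.x := rfl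
@[simp] theorem e_smul (c : k) (p : ZigZagAlg k) : (c • p).e = c * p.e := rfl
@[simp] theorem o_smul (c : k) (p : ZigZagAlg k) : (c • p).o = c * p.o := rfl
@[simp] theorem f_smul (c : k) (p : ZigZagAlg k) : (c • p).f = c * p.f := rfl
@[simp] theorem x_mul (p q : ZigZagAlg k) : (p * q).x = 0 := rfl
@[simp] theorem e_mul (p q : ZigZagAlg k) : (p * q).e = p.o * q.x := rfl
@[simp] theorem o_mul (p q : ZigZagAlg k) : (p * q).o = p.x * q.e - p.f * q.x := rfl
@[simp] theorem f_mul (p q : ZigZagAlg k) : (p * q).f = p.x * q.o := rfl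

instance : NonUnitalNonAssocRing (ZigZagAlg k) where
  add_assoc p q r := by ext <;> simp [add_assoc]
  zero_add p := by ext <;> simp
  add_zero p := by ext <;> simp
  add_comm p q := by ext <;> simp [add_comm]
  neg_add_cancel p := by ext <;> simp
  nsmul := nsmulRec
  zsmul := zsmulRec
  zero_mul p := by ext <;> simp
  mul_zero p := by ext <;> simp
  left_distrib p q r := by ext <;> simp <;> ring
  right_distrib p q r := by ext <;> simp <;> ring

instance : Module k (ZigZagAlg k) where
  one_smul p := by ext <;> simp
  mul_smul a b p := by ext <;> simp [mul_assoc]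
  smul_zero a := by ext <;> simp
  smul_add a p q := by ext <;> simp [mul_add]
  add_smul a b p := by ext <;> simp [add_mul]
  zero_smul p := by ext <;> simp

instance : IsScalarTower k (ZigZagAlg k) (ZigZagAlg k) where
  smul_assoc a p q := by ext <;> simp <;> ring

instance : SMulCommClass k (ZigZagAlg k) (ZigZagAlg k) where
  smul_comm a p q := by ext <;> simp <;> ring

theorem satisfiesW : SatisfiesW 4 (ZigZagAlg k) := fun a => by
  rw [w_four]
  ext <;> simp <;> ring

/-- The basis vector `x`. -/
def basisX : ZigZagAlg k := ⟨1, 0, 0, 0⟩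

/-- The basis vector `e`. -/
def basisE : ZigZagAlg k := ⟨0, 1, 0, 0⟩

/-- The basis vector `o`. -/
def basisO : ZigZagAlg k := ⟨0, 0, 1, 0⟩

theorem basisX_mul_basisE : (basisX * basisE : ZigZagAlg k) = basisO := by
  ext <;> simp [basisX, basisE, basisO]

theorem basisO_mul_basisX : (basisO * basisX : ZigZagAlg k) = basisE := by
  ext <;> simp [basisX, basisE, basisO]

theorem basisO_ne_zero : (basisO : ZigZagAlg k) ≠ 0 := fun h => one_ne_zero (congrArg o h)

theorem basisE_ne_zero : (basisE : ZigZagAlg k) ≠ 0 := fun h => one_ne_zero (congrArg e h)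

variable (k) in
/-- The sequence of arguments in which entry `i` is `o` and all others are `x`. -/
def zigzagArg (i : ℕ) (j : ℕ) : ZigZagAlg k := if j = i then basisO else basisX

/-- If the middle argument is `o` and the others are `x`, the zig-zag monomials alternate between
`o` and `e`, as `o x = e` and `x e = o`. -/
theorem zigzag_zigzagArg (i : ℕ) :
    zigzag (2 * i + 1) (zigzagArg k i) = basisO ∧ zigzag (2 * i + 2) (zigzagArg k i) = basisE := by
  have step (i : ℕ) (h : zigzag (2 * i + 1) (zigzagArg k i) = basisO) :
      zigzag (2 * i + 2) (zigzagArg k i) = basisE := by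
    rw [zigzag, if_pos (even_two_mul i), h, zigzagArg, if_neg (by omega), basisO_mul_basisX]
  induction i with
  | zero =>
    have h : zigzag (2 * 0 + 1) (zigzagArg k 0) = basisO := by
      rw [mul_zero, zero_add, zigzag, zigzagArg, if_pos rfl]
    exact ⟨h, step 0 h⟩
  | succ i ih =>
    have h : zigzag (2 * (i + 1) + 1) (zigzagArg k (i + 1)) = basisO := by
      have shift : (fun j => zigzagArg k (i + 1) (j + 1)) = zigzagArg k i := by
        ext1 j
        simp only [zigzagArg, Nat.add_right_cancel_iff]
      rw [show 2 * (i + 1) + 1 = (2 * i + 1) + 2 by ring, zigzag,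
        if_neg (Nat.not_even_iff_odd.mpr (odd_two_mul_add_one i)), shift, ih.2, zigzagArg,
        if_neg (Nat.succ_ne_zero i).symm, basisX_mul_basisE]
    exact ⟨h, step (i + 1) h⟩

theorem exists_zigzag_ne_zero (n : ℕ) (hn : 1 ≤ n) : ∃ a : ℕ → ZigZagAlg k, zigzag n a ≠ 0 := by
  obtain ⟨i, rfl | rfl⟩ : ∃ i, n = 2 * i + 1 ∨ n = 2 * i + 2 := ⟨(n - 1) / 2, by omega⟩
  · exact ⟨zigzagArg k i, by rw [(zigzag_zigzagArg i).1]; exact basisO_ne_zero⟩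
  · exact ⟨zigzagArg k i, by rw [(zigzag_zigzagArg i).2]; exact basisE_ne_zero⟩

/-- The operator `l_x r_x` fixes `o`, so it is not nilpotent. -/
theorem mulLeft_mul_mulRight_pow_ne_zero (n : ℕ) :
    (LinearMap.mulLeft k (basisX : ZigZagAlg k) * LinearMap.mulRight k basisX) ^ n ≠ 0 := by
  have hfix : ((LinearMap.mulLeft k (basisX : ZigZagAlg k) * LinearMap.mulRight k basisX :
      Module.End k (ZigZagAlg k)) ^ n) basisO = basisO := by
    induction n with
    | zero => rfl
    | succ n ih =>
      rw [pow_succ, Module.End.mul_apply, Module.End.mul_apply, LinearMap.mulRight_apply,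
        LinearMap.mulLeft_apply, basisO_mul_basisX, basisX_mul_basisE, ih]
  intro h
  rw [h] at hfix
  exact basisO_ne_zero hfix.symm

end ZigZagAlg

variable {k}

theorem not_powZero_of_pow_ne_zero {E : Type*} [Ring E] [Algebra k E] {S : NonUnitalSubalgebra k E}
    {t : E} (ht : t ∈ S) {n : ℕ} (hn : t ^ n ≠ 0) : ¬ PowZero S n := fun h =>
  hn (by simpa using h (fun _ => t) fun _ => ht)

theorem ZigZagAlg.not_powZero_multAlg (n : ℕ) : ¬ PowZero (multAlg k (ZigZagAlg k)) n := by
  refine not_powZero_of_pow_ne_zero ?_ (mulLeft_mul_mulRight_pow_ne_zero n)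
  exact mul_mem (NonUnitalAlgebra.subset_adjoin k (Or.inl ⟨_, rfl⟩))
    (NonUnitalAlgebra.subset_adjoin k (Or.inr ⟨_, rfl⟩))

section Env
variable (k) (A : Type*) [NonUnitalNonAssocRing A] [Module k A]
  [IsScalarTower k A A] [SMulCommClass k A A]

/-- The regular representation of the tensor algebra on the symbols `l_a`, `r_a`, sending each
symbol to the multiplication operator of `A` that it stands for. -/
def symRep : TensorAlgebra k (A × A) →ₐ[k] Module.End k A :=
  TensorAlgebra.lift k ((LinearMap.mul k A).coprod (LinearMap.mul k A).flip)

variable {k A}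

theorem symRep_symL (a : A) : symRep k A (symL k A a) = LinearMap.mulLeft k a := by
  ext x
  simp [symRep, symL]

theorem symRep_symR (a : A) : symRep k A (symR k A a) = LinearMap.mulRight k a := by
  ext x
  simp [symRep, symR]

/-- If `w_4 = 0` in `A`, then `A` is a bimodule over itself in the variety, so the regular
representation factors through the universal multiplicative envelope. -/
def envRep (hA : SatisfiesW 4 A) : UnitalEnv k A →ₐ[k] Module.End k A :=
  RingQuot.liftAlgHom k ⟨symRep k A, fun _ _ h => by
    ext x
    cases h with
    | arg1 b c d =>
      have := w_four_eq_zero hA x b c d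
      simp [symRep_symR, ← this]; abel
    | arg2 a c d =>
      have := w_four_eq_zero hA a x c d
      simp [symRep_symL, symRep_symR, ← this]; abel
    | arg3 a b d =>
      have := w_four_eq_zero hA a b x d
      simp [symRep_symL, symRep_symR, ← this]; abel
    | arg4 a b c =>
      have := w_four_eq_zero hA a b c x
      simp [symRep_symL, ← this]; abel⟩

end Env

theorem ZigZagAlg.not_powZero_univMultEnv (n : ℕ) : ¬ PowZero (univMultEnv k (ZigZagAlg k)) n := by
  refine not_powZero_of_pow_ne_zero
    (t := RingQuot.mkAlgHom k (EnvRel k (ZigZagAlg k)) (symL k _ basisX) *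
      RingQuot.mkAlgHom k (EnvRel k (ZigZagAlg k)) (symR k _ basisX)) ?_ fun h => ?_
  · exact mul_mem (NonUnitalAlgebra.subset_adjoin k (Or.inl ⟨_, rfl⟩))
      (NonUnitalAlgebra.subset_adjoin k (Or.inr ⟨_, rfl⟩))
  · have h' := congrArg (envRep satisfiesW) h
    simp only [map_pow, map_mul, map_zero, envRep, RingQuot.liftAlgHom_mkAlgHom_apply, symRep_symL,
      symRep_symR] at h'
    exact mulLeft_mul_mulRight_pow_ne_zero n h'

end ZigZag

/-! ### An algebra in which the exponent seven is attained -/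

section Sharp

variable (k : Type*) [Field k]

/-- A ten-dimensional algebra, graded with its basis vector `x` in degree one and the basis vectors
`m = x x`, `r3 = x m`, `l3 = m x`, `r4 = x r3`, `l4 = l3 x`, `r5 = x r4`, `l5 = l4 x`,
`c6 = x r5 = l5 x` and `c7 = x c6 = c6 x` in degrees two to seven. -/
@[ext]
structure SharpAlg where
  /-- the coordinate at `x` -/
  x : k
  /-- the coordinate at `m` -/
  m : k
  /-- the coordinate at `r3` -/
  r3 : k
  /-- the coordinate at `l3` -/
  l3 : k
  /-- the coordinate at `r4` -/
  r4 : k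
  /-- the coordinate at `l4` -/
  l4 : k
  /-- the coordinate at `r5` -/
  r5 : k
  /-- the coordinate at `l5` -/
  l5 : k
  /-- the coordinate at `c6` -/
  c6 : k
  /-- the coordinate at `c7` -/
  c7 : k

namespace SharpAlg

variable {k}

instance : Zero (SharpAlg k) := ⟨⟨0, 0, 0, 0, 0, 0, 0, 0, 0, 0⟩⟩

instance : Add (SharpAlg k) :=
  ⟨fun p q => ⟨p.x + q.x, p.m + q.m, p.r3 + q.r3, p.l3 + q.l3, p.r4 + q.r4, p.l4 + q.l4, p.r5 + q.r5, p.l5 + q.l5, p.c6 + q.c6, p.c7 + q.c7⟩⟩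

instance : Neg (SharpAlg k) :=
  ⟨fun p => ⟨-p.x, -p.m, -p.r3, -p.l3, -p.r4, -p.l4, -p.r5, -p.l5, -p.c6, -p.c7⟩⟩

instance : SMul k (SharpAlg k) :=
  ⟨fun c p => ⟨c * p.x, c * p.m, c * p.r3, c * p.l3, c * p.r4, c * p.l4, c * p.r5, c * p.l5, c * p.c6, c * p.c7⟩⟩

instance : Mul (SharpAlg k) where
  mul p q :=
    { x := 0
      m := p.x * q.x
      r3 := p.x * q.m
      l3 := p.m * q.x
      r4 := p.x * q.r3 - p.x * q.l3
      l4 := p.l3 * q.x - p.x * q.l3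
      r5 := p.x * q.r4 - p.x * q.l4 - 2 * (p.m * q.r3) + p.m * q.l3 + p.l3 * q.m - p.r4 * q.x
      l5 := p.m * q.r3 + p.r3 * q.m - 2 * (p.l3 * q.m) + p.l4 * q.x
      c6 := p.x * q.r5 + p.r3 * q.r3 - 2 * (p.r3 * q.l3) + p.l3 * q.l3 + p.l5 * q.x
      c7 := p.x * q.c6 + p.m * q.l5 + p.r3 * q.l4 - p.l3 * q.r4 + p.r4 * q.l3 - p.l4 * q.l3
      + p.r5 * q.m + p.c6 * q.x }

@[simp] theorem x_zero : (0 : SharpAlg k).x = 0 := rfl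
@[simp] theorem m_zero : (0 : SharpAlg k).m = 0 := rfl
@[simp] theorem r3_zero : (0 : SharpAlg k).r3 = 0 := rfl
@[simp] theorem l3_zero : (0 : SharpAlg k).l3 = 0 := rfl
@[simp] theorem r4_zero : (0 : SharpAlg k).r4 = 0 := rfl
@[simp] theorem l4_zero : (0 : SharpAlg k).l4 = 0 := rfl
@[simp] theorem r5_zero : (0 : SharpAlg k).r5 = 0 := rfl
@[simp] theorem l5_zero : (0 : SharpAlg k).l5 = 0 := rfl
@[simp] theorem c6_zero : (0 : SharpAlg k).c6 = 0 := rfl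
@[simp] theorem c7_zero : (0 : SharpAlg k).c7 = 0 := rfl
@[simp] theorem x_add (p q : SharpAlg k) : (p + q).x = p.x + q.x := rfl
@[simp] theorem m_add (p q : SharpAlg k) : (p + q).m = p.m + q.m := rfl
@[simp] theorem r3_add (p q : SharpAlg k) : (p + q).r3 = p.r3 + q.r3 := rfl
@[simp] theorem l3_add (p q : SharpAlg k) : (p + q).l3 = p.l3 + q.l3 := rfl
@[simp] theorem r4_add (p q : SharpAlg k) : (p + q).r4 = p.r4 + q.r4 := rfl
@[simp] theorem l4_add (p q : SharpAlg k) : (p + q).l4 = p.l4 + q.l4 := rfl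
@[simp] theorem r5_add (p q : SharpAlg k) : (p + q).r5 = p.r5 + q.r5 := rfl
@[simp] theorem l5_add (p q : SharpAlg k) : (p + q).l5 = p.l5 + q.l5 := rfl
@[simp] theorem c6_add (p q : SharpAlg k) : (p + q).c6 = p.c6 + q.c6 := rfl
@[simp] theorem c7_add (p q : SharpAlg k) : (p + q).c7 = p.c7 + q.c7 := rfl
@[simp] theorem x_neg (p : SharpAlg k) : (-p).x = -p.x := rfl
@[simp] theorem m_neg (p : SharpAlg k) : (-p).m = -p.m := rfl
@[simp] theorem r3_neg (p : SharpAlg k) : (-p).r3 = -p.r3 := rfl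
@[simp] theorem l3_neg (p : SharpAlg k) : (-p).l3 = -p.l3 := rfl
@[simp] theorem r4_neg (p : SharpAlg k) : (-p).r4 = -p.r4 := rfl
@[simp] theorem l4_neg (p : SharpAlg k) : (-p).l4 = -p.l4 := rfl
@[simp] theorem r5_neg (p : SharpAlg k) : (-p).r5 = -p.r5 := rfl
@[simp] theorem l5_neg (p : SharpAlg k) : (-p).l5 = -p.l5 := rfl
@[simp] theorem c6_neg (p : SharpAlg k) : (-p).c6 = -p.c6 := rfl
@[simp] theorem c7_neg (p : SharpAlg k) : (-p).c7 = -p.c7 := rfl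
@[simp] theorem x_smul (c : k) (p : SharpAlg k) : (c • p).x = c * p.x := rfl
@[simp] theorem m_smul (c : k) (p : SharpAlg k) : (c • p).m = c * p.m := rfl
@[simp] theorem r3_smul (c : k) (p : SharpAlg k) : (c • p).r3 = c * p.r3 := rfl
@[simp] theorem l3_smul (c : k) (p : SharpAlg k) : (c • p).l3 = c * p.l3 := rfl
@[simp] theorem r4_smul (c : k) (p : SharpAlg k) : (c • p).r4 = c * p.r4 := rfl
@[simp] theorem l4_smul (c : k) (p : SharpAlg k) : (c • p).l4 = c * p.l4 := rfl
@[simp] theorem r5_smul (c : k) (p : SharpAlg k) : (c • p).r5 = c * p.r5 := rfl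
@[simp] theorem l5_smul (c : k) (p : SharpAlg k) : (c • p).l5 = c * p.l5 := rfl
@[simp] theorem c6_smul (c : k) (p : SharpAlg k) : (c • p).c6 = c * p.c6 := rfl
@[simp] theorem c7_smul (c : k) (p : SharpAlg k) : (c • p).c7 = c * p.c7 := rfl
@[simp] theorem x_mul (p q : SharpAlg k) :
    (p * q).x = 0 := rfl
@[simp] theorem m_mul (p q : SharpAlg k) :
    (p * q).m = p.x * q.x := rfl
@[simp] theorem r3_mul (p q : SharpAlg k) :
    (p * q).r3 = p.x * q.m := rfl
@[simp] theorem l3_mul (p q : SharpAlg k) :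
    (p * q).l3 = p.m * q.x := rfl
@[simp] theorem r4_mul (p q : SharpAlg k) :
    (p * q).r4 = p.x * q.r3 - p.x * q.l3 := rfl
@[simp] theorem l4_mul (p q : SharpAlg k) :
    (p * q).l4 = p.l3 * q.x - p.x * q.l3 := rfl
@[simp] theorem r5_mul (p q : SharpAlg k) :
    (p * q).r5 = p.x * q.r4 - p.x * q.l4 - 2 * (p.m * q.r3) + p.m * q.l3 + p.l3 * q.m - p.r4 * q.x := rfl
@[simp] theorem l5_mul (p q : SharpAlg k) :
    (p * q).l5 = p.m * q.r3 + p.r3 * q.m - 2 * (p.l3 * q.m) + p.l4 * q.x := rfl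
@[simp] theorem c6_mul (p q : SharpAlg k) :
    (p * q).c6 = p.x * q.r5 + p.r3 * q.r3 - 2 * (p.r3 * q.l3) + p.l3 * q.l3 + p.l5 * q.x := rfl
@[simp] theorem c7_mul (p q : SharpAlg k) :
    (p * q).c7 = p.x * q.c6 + p.m * q.l5 + p.r3 * q.l4 - p.l3 * q.r4 + p.r4 * q.l3 - p.l4 * q.l3
      + p.r5 * q.m + p.c6 * q.x := rfl

instance : NonUnitalNonAssocRing (SharpAlg k) where
  add_assoc p q r := by ext <;> simp [add_assoc]
  zero_add p := by ext <;> simp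
  add_zero p := by ext <;> simp
  add_comm p q := by ext <;> simp [add_comm]
  neg_add_cancel p := by ext <;> simp
  nsmul := nsmulRec
  zsmul := zsmulRec
  zero_mul p := by ext <;> simp
  mul_zero p := by ext <;> simp
  left_distrib p q r := by ext <;> simp <;> ring
  right_distrib p q r := by ext <;> simp <;> ring

instance : Module k (SharpAlg k) where
  one_smul p := by ext <;> simp
  mul_smul a b p := by ext <;> simp [mul_assoc]
  smul_zero a := by ext <;> simp
  smul_add a p q := by ext <;> simp [mul_add]
  add_smul a b p := by ext <;> simp [add_mul]
  zero_smul p := by ext <;> simp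

instance : IsScalarTower k (SharpAlg k) (SharpAlg k) where
  smul_assoc a p q := by ext <;> simp <;> ring

instance : SMulCommClass k (SharpAlg k) (SharpAlg k) where
  smul_comm a p q := by ext <;> simp <;> ring

theorem satisfiesW : SatisfiesW 4 (SharpAlg k) := fun a => by
  rw [w_four]
  ext <;> simp <;> ring

/-- The basis vector `x`. -/
def basisX : SharpAlg k := ⟨1, 0, 0, 0, 0, 0, 0, 0, 0, 0⟩

theorem mulLeft_pow_six_ne_zero : LinearMap.mulLeft k (basisX : SharpAlg k) ^ 6 ≠ 0 := fun h => by
  have h' := congrArg c7 (LinearMap.congr_fun h basisX)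
  simp [pow_succ, basisX] at h'

theorem mulRight_pow_six_ne_zero : LinearMap.mulRight k (basisX : SharpAlg k) ^ 6 ≠ 0 := fun h => by
  have h' := congrArg c7 (LinearMap.congr_fun h basisX)
  simp [pow_succ, basisX] at h'

theorem not_powZero_leftAlg : ¬ PowZero (leftAlg k (SharpAlg k)) 6 := by
  refine not_powZero_of_pow_ne_zero ?_ mulLeft_pow_six_ne_zero
  exact NonUnitalAlgebra.subset_adjoin k ⟨_, rfl⟩

theorem not_powZero_rightAlg : ¬ PowZero (rightAlg k (SharpAlg k)) 6 := by
  refine not_powZero_of_pow_ne_zero ?_ mulRight_pow_six_ne_zero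
  exact NonUnitalAlgebra.subset_adjoin k ⟨_, rfl⟩

end SharpAlg

end Sharp

end WeakNil

/-- Over a field of characteristic zero: for every algebra with `w_4 = 0`, both `L(A)` and `R(A)`
are nilpotent with `L(A)^7 = 0` and `R(A)^7 = 0`; the exponent `7` is optimal for both; and there
is an algebra with `w_4 = 0` in which no zig-zag monomial vanishes identically and for which `U(A)`
and its image in the operators on `A` are not nilpotent. -/
theorem mainTheorem1 {k : Type u} [Field k] [CharZero k] :
    (∀ (A : Type v) [NonUnitalNonAssocRing A] [Module k A] [IsScalarTower k A A]
        [SMulCommClass k A A], WeakNil.SatisfiesW 4 A →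
        WeakNil.PowZero (WeakNil.leftAlg k A) 7 ∧ WeakNil.PowZero (WeakNil.rightAlg k A) 7) ∧
    (∃ (A : Type u) (_ : NonUnitalNonAssocRing A) (_ : Module k A) (_ : IsScalarTower k A A)
        (_ : SMulCommClass k A A), WeakNil.SatisfiesW 4 A ∧
        ¬ WeakNil.PowZero (WeakNil.leftAlg k A) 6 ∧
        ¬ WeakNil.PowZero (WeakNil.rightAlg k A) 6) ∧
    (∃ (A : Type u) (_ : NonUnitalNonAssocRing A) (_ : Module k A) (_ : IsScalarTower k A A)
        (_ : SMulCommClass k A A), WeakNil.SatisfiesW 4 A ∧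
        (∀ n : ℕ, 1 ≤ n → ∃ a : ℕ → A, WeakNil.zigzag n a ≠ 0) ∧
        (∀ n : ℕ, ¬ WeakNil.PowZero (WeakNil.multAlg k A) n) ∧
        (∀ n : ℕ, ¬ WeakNil.PowZero (WeakNil.univMultEnv k A) n)) := by
  refine ⟨fun A _ _ _ _ hA => ⟨WeakNil.powZero_leftAlg k hA, WeakNil.powZero_rightAlg k hA⟩, ?_, ?_⟩
  · exact ⟨WeakNil.SharpAlg k, inferInstance, inferInstance, inferInstance, inferInstance,
      WeakNil.SharpAlg.satisfiesW, WeakNil.SharpAlg.not_powZero_leftAlg,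
      WeakNil.SharpAlg.not_powZero_rightAlg⟩
  · exact ⟨WeakNil.ZigZagAlg k, inferInstance, inferInstance, inferInstance, inferInstance,
      WeakNil.ZigZagAlg.satisfiesW, WeakNil.ZigZagAlg.exists_zigzag_ne_zero,
      WeakNil.ZigZagAlg.not_powZero_multAlg, WeakNil.ZigZagAlg.not_powZero_univMultEnv⟩
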